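/- **Conventions.** A non-commutative probability space is a complex unital $*$-algebra $\mathcal A$ with a linear form $\varphi$ such that $\varphi(1)=1$, $\varphi(x^*)=\overline{\varphi(x)}$ and $\varphi(xx^*)\ge 0$ for all $x\in\mathcal A$. The distribution of a family $(x_i)_{i\in I}$ of elements is the map $P\mapsto\varphi(P((x_i)_{i\in I}))$ on polynomials in non-commuting variables indexed by $I$. *The family $(M_r(1))$.* Let $\mathcal S$ be the group of finitely supported permutations of $\{0,1,2,\dots\}$ and $\phi$ the trace $\phi(\sum_\sigma x_\sigma\sigma)=x_{\mathrm{id}}$ on $\mathbb C[\mathcal S]$. For $r\ge 0$, $n\ge1$, $t\ge 0$ let $$M_r(n,t)=n^{-r/2}\sum (0\,a_1\,a_2\cdots a_r)\in\mathbb C[\mathcal S],$$ the sum running over the $r$-tuples of pairwise distinct integers of $[1,nt]$ (so $M_0(n,t)=\mathrm{id}$). The families $(M_r(n,t))_{r,t}$ converge in distribution, as $n\to\infty$, to a family $(M_r(t))_{r\ge 0,\,t\ge 0}$ such that $(M_1(t))_{t\ge0}$ is a free Brownian motion (its increments are free and $M_1(t)$ is semi-circular with variance $t$) and $M_r(t)=t^{r/2}U_r(t^{-1/2}M_1(t))$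 for $t>0$, where $U_0=1$, $U_1=X$, $U_{r+1}=XU_r-U_{r-1}$ are the Chebyshev polynomials of the second kind on $[-2,2]$. *The Toeplitz operators.* Let $S$ be the shift $Se_i=e_{i+1}$ on $\ell^2(\mathbb N)$, with orthonormal basis $(e_i)_{i\ge0}$, let $\mathcal T$ be the Toeplitz algebra (the closed unital $*$-algebra of bounded operators generated by $S$), let $\omega(T)=\langle e_0,Te_0\rangle$ be its vacuum state, and for $r\ge0$ put $$T_r=\sum_{k=0}^{r}S^{r-k}S^{*k}.$$ **Proposition (Toeplitz model).** $(\mathcal T,\omega)$ is a non-commutative probability space, the $T_r$ are self-adjoint, and the families $(T_r)_{r\ge0}$ in $(\mathcal T,\omega)$ and $(M_r(1))_{r\ge0}$ have the same distribution. That is: 1. for every polynomial $P$ in the non-commuting variables $(X_r)_{r\ge0}$, $$\lim_{n\to\infty}\phi\big(P((M_r(n,1))_{r\ge0})\big)=\omega\big(P((T_r)_{r\ge0})\big);$$ 2. for every non-commutative probability space $(\mathcal A,\varphi)$ and every family $(M_r(t))_{r\ge0,\,t\ge0}$ in $\mathcal A$ such that $(M_1(t))_{t\ge0}$ is a free Brownian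 motion and $M_r(t)=t^{r/2}U_r(t^{-1/2}M_1(t))$ for all $r\ge 0$, $t>0$, and for every such $P$, $$\varphi\big(P((M_r(1))_{r\ge0})\big)=\omega\big(P((T_r)_{r\ge0})\big).$$ -/

import Mathlib

open scoped NNReal ComplexOrder

noncomputable section

namespace ToeplitzModel

/-! ### Non-commutative probability spaces and non-commutative distributions -/

section Probability

variable {A : Type*} [Ring A] [StarRing A] [Algebra ℂ A] [StarModule ℂ A]

/-- `(A, φ)` is a non-commutative probability space: the linear form `φ` on the complex unital
`*`-algebra `A` is unital, hermitian and positive. -/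
structure IsNCProbabilitySpace (φ : A →ₗ[ℂ] ℂ) : Prop where
  map_one : φ 1 = 1
  map_star : ∀ x, φ (star x) = star (φ x)
  nonneg : ∀ x, 0 ≤ φ (x * star x)

/-- The element `x` is semi-circular with variance `v`: it is self-adjoint and has the moments of
the image under `y ↦ √v y` of the standard semi-circular law `(2π)⁻¹ √(4 - y²) dy` on `[-2, 2]`
(which is the Dirac mass at `0` when `v = 0`). -/
def IsSemicircular (φ : A →ₗ[ℂ] ℂ) (x : A) (v : ℝ≥0) : Prop :=
  IsSelfAdjoint x ∧ ∀ k : ℕ, φ (x ^ k) =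
    ((∫ y in (-2 : ℝ)..2, (Real.sqrt v * y) ^ k * (Real.sqrt (4 - y ^ 2) / (2 * Real.pi)) : ℝ) : ℂ)

/-- The family `x` is free: an alternating product of centred elements, each taken in the unital
`*`-algebra generated by one of the `x i`, is centred. -/
def IsFree {ι : Type*} (φ : A →ₗ[ℂ] ℂ) (x : ι → A) : Prop :=
  ∀ l : List (ι × A), l ≠ [] →
    (∀ p ∈ l, p.2 ∈ StarAlgebra.adjoin ℂ {x p.1} ∧ φ p.2 = 0) →
    l.IsChain (fun p q => p.1 ≠ q.1) →
    φ (l.map Prod.snd).prod = 0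

/-- A free Brownian motion: free increments, and `B t` is semi-circular with variance `t`. -/
structure IsFreeBrownianMotion (φ : A →ₗ[ℂ] ℂ) (B : ℝ≥0 → A) : Prop where
  semicircular : ∀ t, IsSemicircular φ (B t) t
  free_increments : ∀ (p : ℕ) (t : Fin (p + 1) → ℝ≥0), StrictMono t →
    IsFree φ (fun i : Fin p => B (t i.succ) - B (t i.castSucc))

end Probability

/-- The non-commutative distribution of the family `x`: it maps a polynomial `P` in the
non-commutative variables indexed by `I` to `φ (P(x))`. -/
def ncDistribution {A I : Type*} [Ring A] [Algebra ℂ A] (φ : A →ₗ[ℂ] ℂ) (x : I → A) :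
    FreeAlgebra ℂ I →ₗ[ℂ] ℂ :=
  φ ∘ₗ (FreeAlgebra.lift ℂ x).toLinearMap

/-! ### The permutation model -/

/-- The group of finitely supported permutations of the nonnegative integers. -/
def finPerm : Subgroup (Equiv.Perm ℕ) where
  carrier := {σ | {x | σ x ≠ x}.Finite}
  one_mem' := by simp
  mul_mem' := by
    intro σ τ hσ hτ
    refine (Set.Finite.union hσ hτ).subset fun x hx => ?_
    by_contra h
    simp only [Set.mem_union, Set.mem_ofPred_eq, not_or, not_not] at h
    exact hx (by rw [Equiv.Perm.mul_apply, h.2, h.1])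
  inv_mem' := by
    intro σ hσ
    refine Set.Finite.subset hσ fun x hx h => hx ?_
    rw [Equiv.Perm.inv_eq_iff_eq]
    exact h.symm

theorem formPerm_mem_finPerm (l : List ℕ) : l.formPerm ∈ finPerm := by
  refine (List.finite_toSet l).subset fun x hx => ?_
  by_contra h
  exact hx (List.formPerm_apply_of_notMem h)

/-- The cycle `0 → a 0 → a 1 → ⋯ → a (r - 1) → 0` (for pairwise distinct positive `a i`). -/
def cycle {r : ℕ} (a : Fin r → ℕ) : finPerm :=
  ⟨(0 :: List.ofFn a).formPerm, formPerm_mem_finPerm _⟩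

/-- The canonical trace on the group algebra: the coefficient of the identity. -/
def groupTrace : MonoidAlgebra ℂ finPerm →ₗ[ℂ] ℂ where
  toFun x := x.coeff 1
  map_add' _ _ := by simp
  map_smul' _ _ := by simp

/-- `M_r(n, t) = n^{-r/2} ∑ (0 a₁ ⋯ a_r)`, the sum running over the `r`-tuples of pairwise distinct
integers of `[1, n t]`. -/
def permModel (r n : ℕ) (t : ℝ≥0) : MonoidAlgebra ℂ finPerm :=
  (((n : ℝ) ^ (-(r : ℝ) / 2) : ℝ) : ℂ) •
    ∑ a : Fin r ↪ Finset.Icc 1 ⌊(n : ℝ≥0) * t⌋₊,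
      MonoidAlgebra.of ℂ finPerm (cycle fun i => (a i : ℕ))

/-! ### The Toeplitz model -/

/-- The Hilbert space `ℓ²(ℕ)`. -/
abbrev EllTwo : Type := lp (fun _ : ℕ => ℂ) 2

/-- The right shift of a sequence. -/
def shiftFun (x : ℕ → ℂ) : ℕ → ℂ
  | 0 => 0
  | n + 1 => x n

theorem hasSum_shiftFun (x : EllTwo) :
    HasSum (fun i => ‖shiftFun x i‖ ^ (2 : ENNReal).toReal) (‖x‖ ^ (2 : ENNReal).toReal) := by
  rw [← hasSum_nat_add_iff' 1]
  simpa [shiftFun] using lp.hasSum_norm (p := 2) (by norm_num) x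

/-- The shift, as an isometry: `(S x) 0 = 0` and `(S x) (n + 1) = x n`. -/
def shiftIsometry : EllTwo →ₗᵢ[ℂ] EllTwo where
  toFun x := ⟨shiftFun x, memℓp_gen (hasSum_shiftFun x).summable⟩
  map_add' x y := by
    ext i
    cases i with
    | zero => exact (add_zero (0 : ℂ)).symm
    | succ n => rfl
  map_smul' c x := by
    ext i
    cases i <;> simp [shiftFun]
  norm_map' x := by
    have h := lp.norm_rpow_eq_tsum (p := 2) (by norm_num)
      (⟨shiftFun x, memℓp_gen (hasSum_shiftFun x).summable⟩ : EllTwo)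
    have h2 := (hasSum_shiftFun x).tsum_eq
    exact (Real.rpow_left_inj (norm_nonneg _) (norm_nonneg _) (by norm_num)).1 (h.trans h2)

/-- The shift operator on `ℓ²(ℕ)`. -/
def shiftOp : EllTwo →L[ℂ] EllTwo := shiftIsometry.toContinuousLinearMap

/-- The Toeplitz algebra: the closed unital `*`-algebra of operators generated by the shift. -/
def toeplitzAlgebra : StarSubalgebra ℂ (EllTwo →L[ℂ] EllTwo) :=
  StarAlgebra.elemental ℂ shiftOp

/-- The shift as an element of the Toeplitz algebra. -/
def shift : toeplitzAlgebra := ⟨shiftOp, StarAlgebra.elemental.self_mem ℂ shiftOp⟩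

/-- The first vector `e₀` of the canonical basis of `ℓ²(ℕ)`. -/
def e₀ : EllTwo := lp.single 2 0 1

/-- The vacuum state `ω(T) = ⟨e₀, T e₀⟩`. -/
def vacuumState : toeplitzAlgebra →ₗ[ℂ] ℂ where
  toFun T := inner ℂ e₀ ((T : EllTwo →L[ℂ] EllTwo) e₀)
  map_add' _ _ := by simp
  map_smul' _ _ := by simp

/-- `T_r = ∑_{k=0}^r S^{r-k} S*^k`. -/
def toeplitz (r : ℕ) : toeplitzAlgebra :=
  ∑ k ∈ Finset.range (r + 1), shift ^ (r - k) * star shift ^ k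

end ToeplitzModel

end

noncomputable section

namespace ToeplitzModel

open Polynomial Filter Topology

/-! Everything reduces to one variable and to the rescaled Chebyshev polynomials `S r`. Since `S* S
= 1`, the `T_r` satisfy the Chebyshev recurrence, so `T_r = S_r(T_1)`; since `S* e₀ = 0`, `ω(T_r)`
is `1` for `r = 0` and `0` otherwise. The `S r` span all polynomials, so these values determine the
law of `T_1`. The semicircle law of variance `1` gives the same values, which settles the free
Brownian case.

For permutations, multiply `(0 a₁ ⋯ a_{r+1})` by `(0 b)`. A new `b` lengthens the cycle, `b = a₁`
deletes `a₁`, and the other choices form a remainder (`cycleSum_succ_mul_cycleSum_one`). In a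
product equal to the identity no label occurs exactly once, so a word with `R` labels has trace
`O(n^{R/2})`, which the normalization compensates. In the remainder, `a_j` occurs twice and is still
moved; it must occur a third time, and a factor `n^{1/2}` is lost. The recurrence therefore holds
modulo polynomials negligible in trace. As the trace is central, these form a two-sided ideal, so
every polynomial in the `M_r` reduces to one in `M_1`. -/

/-! ### Toeplitz operators and the Chebyshev recurrence -/

theorem star_shift_mul_shift : star shift * shift = 1 := by
  refine Subtype.ext ?_
  change ContinuousLinearMap.adjoint shiftOp * shiftOp = 1
  ext1 x
  refine ext_inner_left ℂ fun y => ?_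
  simp only [mul_apply_eq_comp, one_apply_eq_self,
    ContinuousLinearMap.adjoint_inner_right]
  exact shiftIsometry.inner_map_map y x

theorem star_shiftOp_e₀ : star shiftOp e₀ = 0 := by
  refine ext_inner_right ℂ fun y => ?_
  rw [ContinuousLinearMap.star_eq_adjoint, ContinuousLinearMap.adjoint_inner_left, inner_zero_left]
  rw [e₀, lp.inner_single_left]
  exact inner_zero_right _

theorem inner_e₀_self : inner ℂ e₀ e₀ = 1 := by
  simp [e₀]

theorem isNCProbabilitySpace_vacuumState : IsNCProbabilitySpace vacuumState where
  map_one := inner_e₀_self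
  map_star x := by
    change inner ℂ e₀ (ContinuousLinearMap.adjoint (x : EllTwo →L[ℂ] EllTwo) e₀) = _
    rw [ContinuousLinearMap.adjoint_inner_right]
    exact (inner_conj_symm _ _).symm
  nonneg x := by
    change 0 ≤ inner ℂ e₀ ((x : EllTwo →L[ℂ] EllTwo)
      (ContinuousLinearMap.adjoint (x : EllTwo →L[ℂ] EllTwo) e₀))
    rw [← ContinuousLinearMap.adjoint_inner_left, inner_self_eq_norm_sq_to_K]
    rw [← RCLike.ofReal_pow]
    exact Complex.zero_le_real.2 (sq_nonneg _)

theorem isSelfAdjoint_toeplitz (r : ℕ) : IsSelfAdjoint (toeplitz r) := by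
  rw [IsSelfAdjoint, toeplitz, star_sum, ← Finset.sum_range_reflect]
  refine Finset.sum_congr rfl fun k hk => ?_
  have hk : k ≤ r := Nat.lt_succ_iff.1 (Finset.mem_range.1 hk)
  simp [star_mul, star_pow, Nat.sub_sub_self hk]

theorem toeplitz_zero : toeplitz 0 = 1 := by simp [toeplitz]

theorem toeplitz_one : toeplitz 1 = shift + star shift := by
  simp [toeplitz, Finset.sum_range_succ]

theorem toeplitz_succ (r : ℕ) :
    toeplitz (r + 1) = shift * toeplitz r + star shift ^ (r + 1) := by
  rw [toeplitz, Finset.sum_range_succ, Nat.sub_self, pow_zero, one_mul, toeplitz, Finset.mul_sum]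
  refine congrArg (· + _) (Finset.sum_congr rfl fun k hk => ?_)
  rw [Nat.succ_sub (Nat.lt_succ_iff.1 (Finset.mem_range.1 hk)), pow_succ', mul_assoc]

/-- The Chebyshev recurrence for the Toeplitz operators. -/
theorem toeplitz_add_two (r : ℕ) :
    toeplitz (r + 2) = toeplitz 1 * toeplitz (r + 1) - toeplitz r := by
  rw [toeplitz_one, add_mul, toeplitz_succ (r + 1)]
  -- Only the factor next to `S*` is expanded: `S* S T_r` cancels `T_r`, and `S* S*^{r+1}` is the
  -- last term of `T_{r+2}`.
  nth_rw 3 [toeplitz_succ r]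
  rw [mul_add, ← mul_assoc (star shift), star_shift_mul_shift, one_mul, ← pow_succ']
  abel

theorem aeval_toeplitz_one_S (r : ℕ) : aeval (toeplitz 1) (Chebyshev.S ℂ r) = toeplitz r := by
  induction r using Nat.twoStepInduction with
  | zero => simp [toeplitz_zero]
  | one => simp
  | more r h0 h1 =>
    have := Chebyshev.S_add_two ℂ r
    push_cast at h0 h1 ⊢
    rw [this, map_sub, map_mul, aeval_X, h0, h1, toeplitz_add_two]

/-- In `T_{r+1} = S T_r + S*^{r+1}`, the first term maps into the range of `S`, orthogonal to `e₀`,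
and the second kills `e₀`. -/
theorem vacuumState_toeplitz (r : ℕ) : vacuumState (toeplitz r) = if r = 0 then 1 else 0 := by
  cases r with
  | zero => simpa [toeplitz_zero] using isNCProbabilitySpace_vacuumState.map_one
  | succ r =>
    rw [if_neg r.succ_ne_zero, toeplitz_succ, map_add]
    change inner ℂ e₀ (shiftOp ((toeplitz r : EllTwo →L[ℂ] EllTwo) e₀))
      + inner ℂ e₀ ((star shiftOp ^ (r + 1)) e₀) = 0
    rw [← ContinuousLinearMap.adjoint_inner_left, ← ContinuousLinearMap.star_eq_adjoint,
      star_shiftOp_e₀, pow_succ, mul_apply_eq_comp, star_shiftOp_e₀]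
    simp

/-! ### Chebyshev polynomials as a spanning family -/

/-- The Chebyshev polynomials `S r` span the space of polynomials. -/
theorem span_range_chebyshev_S :
    Submodule.span ℂ (Set.range fun r : ℕ => Chebyshev.S ℂ r) = ⊤ := by
  set V := Submodule.span ℂ (Set.range fun r : ℕ => Chebyshev.S ℂ r)
  have hS (r : ℕ) : Chebyshev.S ℂ r ∈ V := Submodule.subset_span ⟨r, rfl⟩
  -- By the recurrence the span is stable under multiplication by `X`, hence contains every `X ^ k`.
  have hX : ∀ p ∈ V, X * p ∈ V := fun p hp => by
    induction hp using Submodule.span_induction with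
    | mem p hp =>
      obtain ⟨r, rfl⟩ := hp
      cases r with
      | zero => simpa using hS 1
      | succ r =>
        have h : X * Chebyshev.S ℂ (r + 1 : ℕ)
            = Chebyshev.S ℂ (r + 2 : ℕ) + Chebyshev.S ℂ r := by
          have := Chebyshev.S_add_two ℂ r
          push_cast
          rw [this, sub_add_cancel]
        exact h ▸ V.add_mem (hS _) (hS _)
    | zero => simp
    | add p q _ _ hp hq => rw [mul_add]; exact V.add_mem hp hq
    | smul c p _ hp => rw [mul_smul_comm]; exact V.smul_mem c hp
  refine (Submodule.eq_top_iff').2 fun p => ?_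
  induction p using Polynomial.induction_on' with
  | add p q hp hq => exact V.add_mem hp hq
  | monomial k c =>
    rw [← C_mul_X_pow_eq_monomial, ← smul_eq_C_mul]
    refine V.smul_mem c ?_
    induction k with
    | zero => simpa using hS 0
    | succ k ih => rw [pow_succ']; exact hX _ ih

/-- A linear functional on polynomials is determined by its values on Chebyshev polynomials. -/
theorem linearMap_ext_chebyshev_S {f g : ℂ[X] →ₗ[ℂ] ℂ}
    (h : ∀ r : ℕ, f (Chebyshev.S ℂ r) = g (Chebyshev.S ℂ r)) : f = g :=
  LinearMap.ext_on_range span_range_chebyshev_S h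

/-- The polynomial `P((S_r)_r)` in one variable. -/
def chebyshevSubst : FreeAlgebra ℂ ℕ →ₐ[ℂ] ℂ[X] :=
  FreeAlgebra.lift ℂ fun r : ℕ => Chebyshev.S ℂ r

theorem lift_eq_aeval_chebyshevSubst {A : Type*} [Ring A] [Algebra ℂ A] {x : ℕ → A} {a : A}
    (hx : ∀ r : ℕ, x r = aeval a (Chebyshev.S ℂ r)) (P : FreeAlgebra ℂ ℕ) :
    FreeAlgebra.lift ℂ x P = aeval a (chebyshevSubst P) := by
  have : FreeAlgebra.lift ℂ x = (aeval a).comp chebyshevSubst := by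
    ext r
    simp [chebyshevSubst, hx]
  exact DFunLike.congr_fun this P

/-! ### The semicircle law -/

/-- With `y = 2 cos θ` and `S_r(2 cos θ) sin θ = sin((r+1)θ)`, the integrand becomes `(cos rθ - cos
(r+2)θ) / π`, whose integral over `[0, π]` vanishes unless `r = 0`. -/
theorem integral_eval_S_mul_semicircle (r : ℕ) :
    ∫ y in (-2 : ℝ)..2, (Chebyshev.S ℝ r).eval y * (Real.sqrt (4 - y ^ 2) / (2 * Real.pi))
      = if r = 0 then 1 else 0 := by
  -- The bounds run from `π` to `0` because the cosine decreases there.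
  have hsub := intervalIntegral.integral_comp_mul_deriv (a := Real.pi) (b := 0)
    (f := fun θ => 2 * Real.cos θ) (f' := fun θ => 2 * -Real.sin θ)
    (g := fun y => (Chebyshev.S ℝ r).eval y * (Real.sqrt (4 - y ^ 2) / (2 * Real.pi)))
    (fun θ _ => (Real.hasDerivAt_cos θ).const_mul 2) (by fun_prop) (by fun_prop)
  simp only [Real.cos_pi, Real.cos_zero, mul_neg, mul_one] at hsub
  rw [← hsub, intervalIntegral.integral_symm, ← intervalIntegral.integral_neg]
  have hcongr : ∀ θ ∈ Set.uIcc 0 Real.pi,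
      -(-(((fun y => (Chebyshev.S ℝ r).eval y * (Real.sqrt (4 - y ^ 2) / (2 * Real.pi))) ∘
        fun θ => 2 * Real.cos θ) θ * (2 * Real.sin θ)))
      = (Real.cos (r * θ) - Real.cos ((r + 2 : ℕ) * θ)) / Real.pi := by
    intro θ hθ
    rw [Set.uIcc_of_le Real.pi_pos.le] at hθ
    have hs : Real.sqrt (4 - (2 * Real.cos θ) ^ 2) = 2 * Real.sin θ := by
      rw [show 4 - (2 * Real.cos θ) ^ 2 = (2 * Real.sin θ) ^ 2 by
        nlinarith [Real.sin_sq_add_cos_sq θ]]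
      exact Real.sqrt_sq (by have := Real.sin_nonneg_of_mem_Icc hθ; positivity)
    have hS := Chebyshev.S_two_mul_real_cos θ r
    have hc : Real.cos (r * θ) - Real.cos ((r + 2 : ℕ) * θ)
        = 2 * (Real.sin ((r + 1) * θ) * Real.sin θ) := by
      rw [show (r : ℝ) * θ = (r + 1) * θ - θ by ring,
        show ((r + 2 : ℕ) : ℝ) * θ = (r + 1) * θ + θ by push_cast; ring,
        Real.cos_sub, Real.cos_add]
      ring
    simp only [Function.comp_apply, hs, hc]
    push_cast at hS
    rw [← hS]
    field_simp
  rw [intervalIntegral.integral_congr hcongr, intervalIntegral.integral_div,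
    intervalIntegral.integral_sub (Continuous.intervalIntegrable (by fun_prop) _ _)
      (Continuous.intervalIntegrable (by fun_prop) _ _)]
  have hcos (k : ℕ) (hk : k ≠ 0) : ∫ θ in (0 : ℝ)..Real.pi, Real.cos (k * θ) = 0 := by
    rw [intervalIntegral.integral_comp_mul_left _ (by exact_mod_cast hk)]
    simp
  rw [hcos (r + 2) (by omega)]
  split_ifs with h
  · subst h
    simp [Real.pi_ne_zero]
  · rw [hcos r h]
    simp

theorem IsSemicircular.map_aeval {A : Type*} [Ring A] [StarRing A] [Algebra ℂ A] [StarModule ℂ A]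
    {φ : A →ₗ[ℂ] ℂ} {x : A} (hx : IsSemicircular φ x 1) (p : ℝ[X]) :
    φ (aeval x (p.map (algebraMap ℝ ℂ)))
      = ((∫ y in (-2 : ℝ)..2, p.eval y * (Real.sqrt (4 - y ^ 2) / (2 * Real.pi)) : ℝ) : ℂ) := by
  induction p using Polynomial.induction_on' with
  | add p q hp hq =>
    rw [Polynomial.map_add, map_add, map_add, hp, hq, ← Complex.ofReal_add,
      ← intervalIntegral.integral_add]
    · simp [add_mul]
    · exact Continuous.intervalIntegrable (by fun_prop) _ _
    · exact Continuous.intervalIntegrable (by fun_prop) _ _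
  | monomial k c =>
    have := hx.2 k
    simp only [NNReal.coe_one, Real.sqrt_one, one_mul] at this
    simp [aeval_monomial, ← Algebra.smul_def, this, mul_assoc]

/-- Semi-circular elements of variance `1` have the distribution of `T_1`. -/
theorem IsSemicircular.map_aeval_eq_vacuumState {A : Type*} [Ring A] [StarRing A] [Algebra ℂ A]
    [StarModule ℂ A] {φ : A →ₗ[ℂ] ℂ} {x : A} (hx : IsSemicircular φ x 1) (p : ℂ[X]) :
    φ (aeval x p) = vacuumState (aeval (toeplitz 1) p) := by
  refine DFunLike.congr_fun (linearMap_ext_chebyshev_S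
    (f := φ ∘ₗ (aeval x).toLinearMap)
    (g := vacuumState ∘ₗ (aeval (toeplitz 1)).toLinearMap) fun r => ?_) p
  simp only [LinearMap.comp_apply, AlgHom.toLinearMap_apply, aeval_toeplitz_one_S,
    vacuumState_toeplitz]
  rw [← Chebyshev.map_S (algebraMap ℝ ℂ), hx.map_aeval, integral_eval_S_mul_semicircle]
  split_ifs <;> simp

/-! ### Cycles, transpositions and the trace -/

/-- The transposition acts first, so `x` goes to `b` and `b` to the former image of `x`: the entry
`b` is inserted just after `x`. -/
theorem formPerm_cons_mul_swap {l : List ℕ} {x b : ℕ} (h : (x :: b :: l).Nodup) :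
    (x :: l).formPerm * Equiv.swap x b = (x :: b :: l).formPerm := by
  cases l with
  | nil => simp
  | cons c l =>
    have hxb : x ≠ b := by grind
    have hbc : b ≠ c := by grind
    have hxc : x ≠ c := by grind
    have hb : b ∉ x :: c :: l := by grind
    rw [Equiv.mul_swap_eq_swap_mul, List.formPerm_apply_head x c l (by grind),
      List.formPerm_apply_of_notMem hb]
    simp only [List.formPerm_cons_cons]
    rw [← mul_assoc, ← mul_assoc]
    congr 1
    rw [Equiv.mul_swap_eq_swap_mul, Equiv.swap_apply_of_ne_of_ne hxc hxb, Equiv.swap_apply_left,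
      Equiv.swap_comm c b]

theorem formPerm_cons_cons_mul_swap {l : List ℕ} {x b : ℕ} (h : (x :: b :: l).Nodup) :
    (x :: b :: l).formPerm * Equiv.swap x b = (x :: l).formPerm := by
  rw [← formPerm_cons_mul_swap h, mul_assoc, Equiv.swap_mul_self, mul_one]

theorem groupTrace_of (σ : finPerm) [Decidable (σ = 1)] :
    groupTrace (MonoidAlgebra.of ℂ finPerm σ) = if σ = 1 then 1 else 0 := by
  change (MonoidAlgebra.single σ (1 : ℂ)).coeff 1 = _
  rw [MonoidAlgebra.coeff_single, Finsupp.single_apply]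

theorem groupTrace_mul_comm (x y : MonoidAlgebra ℂ finPerm) :
    groupTrace (x * y) = groupTrace (y * x) := by
  classical
  induction x using MonoidAlgebra.induction_on with
  | of σ =>
    induction y using MonoidAlgebra.induction_on with
    | of τ => simp only [← map_mul, groupTrace_of, mul_eq_one_comm (a := σ)]
    | add x y hx hy => rw [mul_add, add_mul, map_add, map_add, hx, hy]
    | smul c x hx => rw [mul_smul_comm, smul_mul_assoc, map_smul, map_smul, hx]
  | add x y hx hy => rw [mul_add, add_mul, map_add, map_add, hx, hy]
  | smul c x hx => rw [mul_smul_comm, smul_mul_assoc, map_smul, map_smul, hx]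

/-! ### Counting the labels of trivial products -/

/-- The list `l` controls the permutation `σ`: nonzero points outside `l` are fixed, nonzero points
that occur exactly once in `l` are moved. -/
def Controls (l : List ℕ) (σ : finPerm) : Prop :=
  ∀ v, v ≠ 0 → (v ∉ l → (σ : Equiv.Perm ℕ) v = v) ∧
    (l.count v = 1 → (σ : Equiv.Perm ℕ) v ≠ v)

theorem controls_nil_one : Controls [] 1 := fun v _ => by simp

theorem mul_apply_eq_self_iff_left {σ τ : finPerm} {v : ℕ} (h : (τ : Equiv.Perm ℕ) v = v) :
    ((σ * τ : finPerm) : Equiv.Perm ℕ) v = v ↔ (σ : Equiv.Perm ℕ) v = v := by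
  rw [Subgroup.coe_mul, Equiv.Perm.mul_apply, h]

theorem mul_apply_eq_self_iff_right {σ τ : finPerm} {v : ℕ} (h : (σ : Equiv.Perm ℕ) v = v) :
    ((σ * τ : finPerm) : Equiv.Perm ℕ) v = v ↔ (τ : Equiv.Perm ℕ) v = v := by
  rw [Subgroup.coe_mul, Equiv.Perm.mul_apply]
  nth_rw 2 [← h]
  exact (σ : Equiv.Perm ℕ).injective.eq_iff

/-- A point occurring once in `l ++ l'` lies in only one of the lists; one factor moves it and the
other fixes it. -/
theorem Controls.mul {l l' : List ℕ} {σ τ : finPerm} (h : Controls l σ) (h' : Controls l' τ) :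
    Controls (l ++ l') (σ * τ) := by
  intro v hv
  refine ⟨fun hm => ?_, fun hc => ?_⟩
  · rw [List.mem_append, not_or] at hm
    exact (mul_apply_eq_self_iff_left ((h' v hv).1 hm.2)).2 ((h v hv).1 hm.1)
  · rw [List.count_append] at hc
    by_cases hl : v ∈ l'
    · have := List.count_pos_iff.2 hl
      have hl0 : l.count v = 0 := by omega
      exact (mul_apply_eq_self_iff_right ((h v hv).1 (List.count_eq_zero.1 hl0))).not.2
        ((h' v hv).2 (by omega))
    · rw [List.count_eq_zero_of_not_mem hl, add_zero] at hc
      exact (mul_apply_eq_self_iff_left ((h' v hv).1 hl)).not.2 ((h v hv).2 hc)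

theorem Controls.count_ne_one {l : List ℕ} (h : Controls l 1) {v : ℕ} (hv : v ≠ 0) :
    l.count v ≠ 1 := fun hc => (h v hv).2 hc rfl

theorem nodup_cons_ofFn {r n : ℕ} (a : Fin r ↪ Finset.Icc 1 n) :
    (0 :: List.ofFn fun i => (a i : ℕ)).Nodup := by
  rw [List.nodup_cons, List.nodup_ofFn, List.mem_ofFn]
  refine ⟨?_, Subtype.val_injective.comp a.injective⟩
  rintro ⟨i, hi⟩
  have := (Finset.mem_Icc.1 (a i).2).1
  omega

theorem controls_cycle {r n : ℕ} (a : Fin r ↪ Finset.Icc 1 n) :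
    Controls (List.ofFn fun i => (a i : ℕ)) (cycle fun i => (a i : ℕ)) := by
  intro v hv
  refine ⟨fun hm => List.formPerm_apply_of_notMem (by simpa [hv] using hm), fun hc => ?_⟩
  have hm : v ∈ List.ofFn fun i => (a i : ℕ) := List.count_pos_iff.1 (by omega)
  refine (List.formPerm_apply_mem_ne_self_iff _ (nodup_cons_ofFn a) v
    (List.mem_cons_of_mem _ hm)).2 ?_
  have := List.length_pos_of_mem hm
  rw [List.length_cons]
  omega

/-- A sum of permutations of `{0, …, n}` indexed by lists of `R` integers of `[1, n]` that control
the permutations. -/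
structure Expansion (n R : ℕ) where
  /-- The index type of the sum. -/
  Index : Type
  [fintype : Fintype Index]
  /-- The labels. -/
  label : Index → List ℕ
  /-- The terms of the sum. -/
  perm : Index → finPerm
  label_injective : Function.Injective label
  length_label : ∀ i, (label i).length = R
  mem_Icc : ∀ i, ∀ v ∈ label i, v ∈ Finset.Icc 1 n
  controls : ∀ i, Controls (label i) (perm i)

namespace Expansion

attribute [instance] Expansion.fintype

variable {n R R' : ℕ}

/-- The sum of the permutations of an expansion. -/
def sum (e : Expansion n R) : MonoidAlgebra ℂ finPerm :=
  ∑ i, MonoidAlgebra.of ℂ finPerm (e.perm i)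

/-- The expansion of `1`. -/
def one (n : ℕ) : Expansion n 0 where
  Index := Unit
  label _ := []
  perm _ := 1
  label_injective _ _ _ := rfl
  length_label _ := rfl
  mem_Icc _ _ h := absurd h List.not_mem_nil
  controls _ := controls_nil_one

theorem sum_one (n : ℕ) : (one n).sum = 1 := by
  change ∑ _ : Unit, MonoidAlgebra.of ℂ finPerm 1 = 1
  simp [MonoidAlgebra.one_def]

/-- The product of two expansions. -/
def mul (e : Expansion n R) (e' : Expansion n R') : Expansion n (R + R') where
  Index := e.Index × e'.Index
  label i := e.label i.1 ++ e'.label i.2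
  perm i := e.perm i.1 * e'.perm i.2
  label_injective i j h := by
    have := List.append_inj h ((e.length_label _).trans (e.length_label _).symm)
    exact Prod.ext (e.label_injective this.1) (e'.label_injective this.2)
  length_label i := by rw [List.length_append, e.length_label, e'.length_label]
  mem_Icc i v hv := (List.mem_append.1 hv).elim (e.mem_Icc _ v) (e'.mem_Icc _ v)
  controls i := (e.controls _).mul (e'.controls _)

theorem sum_mul (e : Expansion n R) (e' : Expansion n R') :
    (e.mul e').sum = e.sum * e'.sum := by
  change ∑ i : e.Index × e'.Index, MonoidAlgebra.of ℂ finPerm (e.perm i.1 * e'.perm i.2) = _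
  simp only [map_mul, Fintype.sum_prod_type, sum, Finset.sum_mul_sum]

theorem groupTrace_sum (e : Expansion n R) [DecidablePred fun i => e.perm i = 1] :
    groupTrace e.sum = (Finset.univ.filter fun i => e.perm i = 1).card := by
  simp only [sum, map_sum, groupTrace_of, Finset.sum_boole]

end Expansion

/-- A list of elements of `[1, n]` with at most `m` distinct entries factors through `Fin m`. -/
theorem exists_ofFn_comp_eq {n m : ℕ} (hn : 0 < n) {l : List ℕ}
    (hl : ∀ v ∈ l, v ∈ Finset.Icc 1 n) (hm : l.toFinset.card ≤ m) :
    ∃ (h : Fin l.length → Fin m) (g : Fin m → Finset.Icc 1 n),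
      (List.ofFn fun i => (g (h i) : ℕ)) = l := by
  obtain ⟨f⟩ : Nonempty (l.toFinset ↪ Fin m) :=
    Function.Embedding.nonempty_of_card_le (by simpa only [Fintype.card_coe, Fintype.card_fin] using hm)
  -- A default value is needed on the part of `Fin m` outside the range of `f`.
  have : Nonempty (Finset.Icc 1 n) := ⟨⟨1, Finset.mem_Icc.2 ⟨le_rfl, hn⟩⟩⟩
  refine ⟨fun i => f ⟨l[i], by simp⟩, Function.extend f
    (fun v => ⟨v, hl v (List.mem_toFinset.1 v.2)⟩) (fun _ => Classical.arbitrary _), ?_⟩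
  simp only [f.injective.extend_apply]
  exact List.ofFn_getElem

namespace Expansion

variable {n R : ℕ}

/-- The trace counts the indices of identity terms, and injectivity of labels turns this into
counting lists. Such a list factors as `Fin R → Fin m → [1, n]`, whence `m ^ R * n ^ m`. -/
theorem norm_groupTrace_sum_le (e : Expansion n R) (hn : 0 < n) {m : ℕ}
    (h : ∀ i, e.perm i = 1 → (e.label i).toFinset.card ≤ m) :
    ‖groupTrace e.sum‖ ≤ (m : ℝ) ^ R * (n : ℝ) ^ m := by
  classical
  rw [groupTrace_sum, Complex.norm_natCast]
  have hcard : (Finset.univ.filter fun i => e.perm i = 1).card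
      ≤ (Finset.univ : Finset ((Fin R → Fin m) × (Fin m → Finset.Icc 1 n))).card := by
    rw [← Finset.card_image_of_injective _ e.label_injective]
    refine (Finset.card_le_card ?_).trans (Finset.card_image_le
      (f := fun p : (Fin R → Fin m) × (Fin m → Finset.Icc 1 n) =>
        List.ofFn fun i => (p.2 (p.1 i) : ℕ)))
    intro l hl
    obtain ⟨i, hi, rfl⟩ := Finset.mem_image.1 hl
    obtain ⟨f, g, hfg⟩ := exists_ofFn_comp_eq hn (e.mem_Icc i) (h i (Finset.mem_filter.1 hi).2)
    refine Finset.mem_image.2 ⟨(f ∘ Fin.cast (e.length_label i).symm, g), Finset.mem_univ _, ?_⟩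
    exact (List.ofFn_congr (e.length_label i) fun j => (g (f j) : ℕ)).symm.trans hfg
  rw [Finset.card_univ, Fintype.card_prod, Fintype.card_fun, Fintype.card_fun, Fintype.card_fin,
    Fintype.card_fin, Fintype.card_coe, Nat.card_Icc, Nat.add_sub_cancel] at hcard
  exact_mod_cast hcard

theorem two_le_count_label (e : Expansion n R) {i : e.Index} (hi : e.perm i = 1) {v : ℕ}
    (hv : v ∈ (e.label i).toFinset) : 2 ≤ (e.label i).count v := by
  have hv := List.mem_toFinset.1 hv
  have h0 := Finset.mem_Icc.1 (e.mem_Icc i v hv)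
  have h1 := List.count_pos_iff.2 hv
  have h2 := (hi ▸ e.controls i).count_ne_one (v := v) (by omega)
  omega

theorem two_mul_card_toFinset_label_le (e : Expansion n R) {i : e.Index} (hi : e.perm i = 1) :
    2 * (e.label i).toFinset.card ≤ R := by
  refine le_of_le_of_eq ?_ (e.length_label i)
  rw [← List.sum_toFinset_count_eq_length, mul_comm, ← smul_eq_mul]
  exact Finset.card_nsmul_le_sum _ _ _ fun v hv => e.two_le_count_label hi hv

theorem two_mul_card_toFinset_label_lt (e : Expansion n R) {i : e.Index} (hi : e.perm i = 1)
    {w : ℕ} (hw : 2 < (e.label i).count w) :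
    2 * (e.label i).toFinset.card < R := by
  refine lt_of_lt_of_eq ?_ (e.length_label i)
  rw [← List.sum_toFinset_count_eq_length, mul_comm, ← smul_eq_mul, ← Finset.sum_const]
  exact Finset.sum_lt_sum (fun v hv => e.two_le_count_label hi hv)
    ⟨w, List.mem_toFinset.2 (List.count_pos_iff.1 (by omega)), hw⟩

theorem norm_groupTrace_sum_le_half (e : Expansion n R) (hn : 0 < n) :
    ‖groupTrace e.sum‖ ≤ ((R / 2 : ℕ) : ℝ) ^ R * (n : ℝ) ^ (R / 2) :=
  e.norm_groupTrace_sum_le hn fun _ hi => by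
    have := e.two_mul_card_toFinset_label_le hi
    omega

/-- The trace of a product is small when each term of the first factor moves a point that occurs
exactly twice in its label. -/
theorem norm_groupTrace_sum_mul_le {R' : ℕ} (e : Expansion n R) (e' : Expansion n R') (hn : 0 < n)
    (he : ∀ i, ∃ v, v ≠ 0 ∧ (e.label i).count v = 2 ∧ (e.perm i : Equiv.Perm ℕ) v ≠ v) :
    ‖groupTrace (e.sum * e'.sum)‖ ≤
      (((R + R' - 1) / 2 : ℕ) : ℝ) ^ (R + R') * (n : ℝ) ^ ((R + R' - 1) / 2) := by
  rw [← sum_mul]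
  refine norm_groupTrace_sum_le _ hn fun i hi => ?_
  obtain ⟨v, hv0, hv2, hv⟩ := he i.1
  -- The second factor has to undo the motion of `v`, so `v` occurs at least a third time.
  have hmem : v ∈ e'.label i.2 := by
    by_contra hm
    refine (mul_apply_eq_self_iff_left ((e'.controls i.2 v hv0).1 hm)).not.2 hv ?_
    change ((e.mul e').perm i : Equiv.Perm ℕ) v = v
    rw [hi]
    rfl
  have := (e.mul e').two_mul_card_toFinset_label_lt hi (w := v) (by
    change 2 < (e.label i.1 ++ e'.label i.2).count v
    rw [List.count_append]
    have := List.count_pos_iff.2 hmem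
    omega)
  omega

end Expansion

/-! ### The recurrence for sums of cycles -/

/-- The unnormalized sum `∑ (0 a₁ ⋯ a_r)` over the `r`-tuples of distinct integers of `[1, n]`. -/
def cycleSum (r n : ℕ) : MonoidAlgebra ℂ finPerm :=
  ∑ a : Fin r ↪ Finset.Icc 1 n, MonoidAlgebra.of ℂ finPerm (cycle fun i => (a i : ℕ))

/-- The expansion of `cycleSum r n`. -/
def cycleExpansion (r n : ℕ) : Expansion n r where
  Index := Fin r ↪ Finset.Icc 1 n
  label a := List.ofFn fun i => (a i : ℕ)
  perm a := cycle fun i => (a i : ℕ)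
  label_injective a b h :=
    DFunLike.ext _ _ fun i => Subtype.ext (congrFun (List.ofFn_injective h) i)
  length_label _ := List.length_ofFn
  mem_Icc a v hv := by
    obtain ⟨i, rfl⟩ := List.mem_ofFn.1 hv
    exact (a i).2
  controls := controls_cycle

theorem sum_cycleExpansion (r n : ℕ) : (cycleExpansion r n).sum = cycleSum r n := rfl

theorem exists_expansion_word (n : ℕ) (w : List ℕ) :
    ∃ e : Expansion n w.sum, e.sum = (w.map fun r => cycleSum r n).prod := by
  induction w with
  | nil => exact ⟨Expansion.one n, Expansion.sum_one n⟩
  | cons r w ih =>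
    obtain ⟨e, he⟩ := ih
    have h : ((cycleExpansion r n).mul e).sum = ((r :: w).map fun r => cycleSum r n).prod := by
      rw [Expansion.sum_mul, he, sum_cycleExpansion, List.map_cons, List.prod_cons]
    exact ⟨_, h⟩

theorem coe_cycle_one (b : ℕ) : (cycle fun _ : Fin 1 => b : Equiv.Perm ℕ) = Equiv.swap 0 b := by
  simp [cycle]

theorem coe_cycle {r : ℕ} (a : Fin r → ℕ) :
    (cycle a : Equiv.Perm ℕ) = (0 :: List.ofFn a).formPerm := rfl

/-- The cycle `(0 a₁ ⋯ a_r)` for a tuple of distinct integers of `[1, n]`. -/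
abbrev embCycle {r n : ℕ} (a : Fin r ↪ Finset.Icc 1 n) : finPerm := cycle fun i => (a i : ℕ)

theorem embCycle_mul_swap {r n : ℕ} (a : Fin (r + 1) ↪ Finset.Icc 1 n) :
    (cycle fun i => (a i.succ : ℕ)) * (cycle fun _ : Fin 1 => (a 0 : ℕ)) = embCycle a := by
  refine Subtype.ext ?_
  have h := nodup_cons_ofFn a
  rw [List.ofFn_succ] at h
  rw [Subgroup.coe_mul, coe_cycle_one, coe_cycle, coe_cycle, List.ofFn_succ,
    formPerm_cons_mul_swap h]

theorem embCycle_mul_swap_head {r n : ℕ} (a : Fin (r + 1) ↪ Finset.Icc 1 n) :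
    embCycle a * (cycle fun _ : Fin 1 => (a 0 : ℕ)) = cycle fun i => (a i.succ : ℕ) := by
  refine Subtype.ext ?_
  have h := nodup_cons_ofFn a
  rw [List.ofFn_succ] at h
  rw [Subgroup.coe_mul, coe_cycle_one, coe_cycle, coe_cycle, List.ofFn_succ,
    formPerm_cons_cons_mul_swap h]

theorem embCycle_apply_zero {r n : ℕ} (a : Fin (r + 1) ↪ Finset.Icc 1 n) :
    (embCycle a : Equiv.Perm ℕ) 0 = a 0 := by
  have h := nodup_cons_ofFn a
  rw [List.ofFn_succ] at h
  rw [coe_cycle, List.ofFn_succ, List.formPerm_apply_head _ _ _ h]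

/-- The expansion of the terms `(0 a₁ ⋯ a_{r + 1}) (0 a_j)` with `2 ≤ j`. -/
def remainder (r n : ℕ) : Expansion n (r + 1 + 1) where
  Index := (Fin (r + 1) ↪ Finset.Icc 1 n) × Fin r
  label p := (List.ofFn fun i => (p.1 i : ℕ)) ++ List.ofFn fun _ : Fin 1 => (p.1 p.2.succ : ℕ)
  perm p := embCycle p.1 * cycle fun _ : Fin 1 => (p.1 p.2.succ : ℕ)
  label_injective := by
    rintro ⟨a, i⟩ ⟨b, j⟩ h
    obtain ⟨h1, h2⟩ := List.append_inj h (by simp)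
    obtain rfl : a = b :=
      DFunLike.ext _ _ fun i => Subtype.ext (congrFun (List.ofFn_injective h1) i)
    have h3 := a.injective (Subtype.ext (congrFun (List.ofFn_injective h2) 0))
    exact Prod.ext rfl (Fin.succ_injective r h3)
  length_label _ := by simp
  mem_Icc p v hv := by
    rcases List.mem_append.1 hv with h | h <;> obtain ⟨i, rfl⟩ := List.mem_ofFn.1 h
    exacts [(p.1 i).2, (p.1 p.2.succ).2]
  controls p := (controls_cycle p.1).mul
    (controls_cycle ⟨fun _ : Fin 1 => p.1 p.2.succ, fun _ _ _ => Subsingleton.elim _ _⟩)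

/-- The witness is the repeated entry `a j.succ`: the product sends it to `0` and then to `a 0`, a
different entry. -/
theorem remainder_moves (r n : ℕ) (p : (remainder r n).Index) :
    ∃ v, v ≠ 0 ∧ ((remainder r n).label p).count v = 2 ∧
      ((remainder r n).perm p : Equiv.Perm ℕ) v ≠ v := by
  obtain ⟨a, j⟩ := p
  have h0 := (Finset.mem_Icc.1 (a j.succ).2).1
  refine ⟨a j.succ, by omega, ?_, ?_⟩
  · change ((List.ofFn fun i => (a i : ℕ)) ++ List.ofFn fun _ : Fin 1 => (a j.succ : ℕ)).count _ = 2
    rw [List.count_append, List.count_eq_one_of_mem (List.nodup_cons.1 (nodup_cons_ofFn a)).2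
      (List.mem_ofFn.2 ⟨_, rfl⟩)]
    simp
  · change ((embCycle a * cycle fun _ : Fin 1 => (a j.succ : ℕ) : finPerm) : Equiv.Perm ℕ) _ ≠ _
    rw [Subgroup.coe_mul, Equiv.Perm.mul_apply, coe_cycle_one, Equiv.swap_apply_right,
      embCycle_apply_zero]
    intro h
    exact Fin.succ_ne_zero j (a.injective (Subtype.ext h)).symm

theorem sum_eq_sum_notMem_range_add {ι α M : Type*} [Fintype ι] [Fintype α] [DecidableEq α]
    [AddCommMonoid M] (a : ι ↪ α) (f : α → M) :
    ∑ b, f b = ∑ b : {b // b ∉ Set.range a}, f b + ∑ i, f (a i) := by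
  rw [← Fintype.sum_subtype_add_sum_subtype (fun b => b ∉ Set.range a) f]
  congr 1
  exact (Fintype.sum_equiv ((Equiv.ofInjective a a.injective).trans
    (Equiv.subtypeEquivRight fun b => not_not.symm)) _ _ fun i => rfl).symm

theorem cycleSum_succ (r n : ℕ) :
    cycleSum (r + 1) n = ∑ a : Fin r ↪ Finset.Icc 1 n, ∑ b : {b // b ∉ Set.range a},
      MonoidAlgebra.of ℂ finPerm (embCycle a * cycle fun _ : Fin 1 => (b : ℕ)) := by
  rw [cycleSum, ← (Equiv.embeddingFinSucc r (Finset.Icc 1 n)).symm.sum_comp, Fintype.sum_sigma]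
  refine Fintype.sum_congr _ _ fun a => Fintype.sum_congr _ _ fun b => ?_
  refine congrArg _ ((embCycle_mul_swap _).symm.trans ?_)
  simp [Fin.cons_succ]

theorem sum_cycle_tail (r n : ℕ) :
    ∑ a : Fin (r + 1) ↪ Finset.Icc 1 n,
      MonoidAlgebra.of ℂ finPerm (cycle fun i => (a i.succ : ℕ))
      = ((n : ℂ) - r) • cycleSum r n := by
  rw [cycleSum, ← (Equiv.embeddingFinSucc r (Finset.Icc 1 n)).symm.sum_comp, Fintype.sum_sigma,
    Finset.smul_sum]
  refine Fintype.sum_congr _ _ fun a => ?_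
  -- The existence of `a` makes `n - r` a true subtraction; for `r > n` both sums are empty.
  have hr : r ≤ n := by simpa using Fintype.card_le_of_embedding a
  have hcard : Fintype.card {b // b ∉ Set.range a} = n - r := by
    rw [Fintype.card_subtype_compl, ← Fintype.card_congr (Equiv.ofInjective a a.injective)]
    simp
  simp only [Equiv.coe_embeddingFinSucc_symm, Fin.cons_succ, Finset.sum_const, Finset.card_univ,
    hcard]
  rw [← Nat.cast_smul_eq_nsmul ℂ, Nat.cast_sub hr]

/-- The recurrence for the sums of cycles. -/
theorem cycleSum_succ_mul_cycleSum_one (r n : ℕ) :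
    cycleSum (r + 1) n * cycleSum 1 n
      = cycleSum (r + 2) n + ((n : ℂ) - r) • cycleSum r n + (remainder r n).sum := by
  have h1 : cycleSum 1 n = ∑ b : Finset.Icc 1 n,
      MonoidAlgebra.of ℂ finPerm (cycle fun _ : Fin 1 => (b : ℕ)) :=
    Fintype.sum_equiv Equiv.uniqueEmbeddingEquivResult _ _ fun a => by
      congr 2
  have hrem : (remainder r n).sum = ∑ a : Fin (r + 1) ↪ Finset.Icc 1 n, ∑ j : Fin r,
      MonoidAlgebra.of ℂ finPerm (embCycle a * cycle fun _ : Fin 1 => (a j.succ : ℕ)) :=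
    Fintype.sum_prod_type _
  rw [h1, cycleSum, Finset.sum_mul_sum, cycleSum_succ (r + 1), ← sum_cycle_tail, hrem,
    ← Finset.sum_add_distrib, ← Finset.sum_add_distrib]
  refine Fintype.sum_congr _ _ fun a => ?_
  simp only [← map_mul]
  -- The three cases for `b`: a new integer, the first entry of `a`, a later entry of `a`.
  rw [sum_eq_sum_notMem_range_add a, Fin.sum_univ_succ, embCycle_mul_swap_head, add_assoc]

/-- A nontrivial cycle sends `0` to `a 0 ≥ 1`. The values agree with those of `vacuumState_toeplitz`
for every `n`, before any limit. -/
theorem groupTrace_cycleSum (r n : ℕ) : groupTrace (cycleSum r n) = if r = 0 then 1 else 0 := by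
  classical
  simp only [cycleSum, map_sum, groupTrace_of]
  cases r with
  | zero =>
    have (a : Fin 0 → ℕ) : cycle a = 1 := Subtype.ext (by simp [cycle])
    simp [this]
  | succ r =>
    refine (Finset.sum_eq_zero fun a _ => if_neg fun h => ?_).trans (if_neg r.succ_ne_zero).symm
    have h1 := embCycle_apply_zero a
    have h2 := (Finset.mem_Icc.1 (a 0).2).1
    rw [embCycle, h] at h1
    change 0 = (a 0 : ℕ) at h1
    omega

theorem cycleSum_zero (n : ℕ) : cycleSum 0 n = 1 := by
  have (a : Fin 0 → ℕ) : cycle a = 1 := Subtype.ext (by simp [cycle])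
  simp [cycleSum, this, MonoidAlgebra.one_def]

/-! ### Normalization and asymptotics -/

/-- The normalization `n ^ (-r / 2)`. -/
def scale (r n : ℕ) : ℂ := (((n : ℝ) ^ (-(r : ℝ) / 2) : ℝ) : ℂ)

theorem scale_zero (n : ℕ) : scale 0 n = 1 := by simp [scale]

theorem scale_mul_scale (r s : ℕ) {n : ℕ} (hn : 0 < n) :
    scale r n * scale s n = scale (r + s) n := by
  rw [scale, scale, scale, ← Complex.ofReal_mul, ← Real.rpow_add (by exact_mod_cast hn)]
  congr 2
  push_cast
  ring

theorem scale_two_mul {n : ℕ} (hn : 0 < n) : scale 2 n * n = 1 := by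
  have hn' : (n : ℝ) ≠ 0 := by exact_mod_cast hn.ne'
  rw [scale, show -((2 : ℕ) : ℝ) / 2 = -1 by norm_num, Real.rpow_neg_one]
  exact_mod_cast inv_mul_cancel₀ hn'

theorem norm_scale_mul_pow_le {r k n : ℕ} (hn : 0 < n) (h : 2 * k + 1 ≤ r) :
    ‖scale r n‖ * (n : ℝ) ^ k ≤ (n : ℝ) ^ (-(1 / 2) : ℝ) := by
  have hn' : (0 : ℝ) < n := by exact_mod_cast hn
  rw [scale, Complex.norm_real, Real.norm_of_nonneg (by positivity), ← Real.rpow_natCast,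
    ← Real.rpow_add hn']
  refine Real.rpow_le_rpow_of_exponent_le (by exact_mod_cast hn) ?_
  have : (2 * k + 1 : ℝ) ≤ r := by exact_mod_cast h
  linarith

theorem permModel_one (r n : ℕ) : permModel r n 1 = scale r n • cycleSum r n := by
  -- The bound occurs in the index type of the sum, so it is generalized before substitution.
  have h (N : ℕ) (hN : ⌊(n : ℝ≥0) * 1⌋₊ = N) : permModel r n 1 = scale r n • cycleSum r N := by
    subst hN
    rfl
  exact h n (by rw [mul_one, Nat.floor_natCast])

theorem prod_map_permModel (w : List ℕ) {n : ℕ} (hn : 0 < n) :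
    (w.map fun r => permModel r n 1).prod
      = scale w.sum n • (w.map fun r => cycleSum r n).prod := by
  induction w with
  | nil => simp [scale_zero]
  | cons r w ih =>
    rw [List.map_cons, List.prod_cons, ih, List.map_cons, List.prod_cons, List.sum_cons,
      permModel_one, smul_mul_smul_comm, scale_mul_scale _ _ hn]

/-- The deviation from the Chebyshev recurrence in the permutation model. -/
theorem permModel_recurrence (r : ℕ) {n : ℕ} (hn : 0 < n) :
    permModel (r + 1) n 1 * permModel 1 n 1 - permModel (r + 2) n 1 - permModel r n 1
      = scale (r + 2) n • ((remainder r n).sum - (r : ℂ) • cycleSum r n) := by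
  -- The main part of the coefficient `n - r` restores the scale of `M_r`; its `-r` joins the error.
  have h : scale r n = scale (r + 2) n * n := by
    rw [← scale_mul_scale r 2 hn, mul_assoc, scale_two_mul hn, mul_one]
  simp only [permModel_one]
  rw [smul_mul_smul_comm, scale_mul_scale _ _ hn, cycleSum_succ_mul_cycleSum_one, h]
  module

/-- Put `R = r + 2 + w.sum`. The remainder contributes `O(n^m)` with `m = ⌊(R - 1) / 2⌋` by the
third occurrence, and the correction `r • cycleSum r n` has only `R - 2` labels. Scaling by
`n^{-R/2}` leaves `O(n^{-1/2})`. -/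
theorem tendsto_groupTrace_recurrence_mul (r : ℕ) (w : List ℕ) :
    Tendsto (fun n : ℕ => groupTrace
      ((permModel (r + 1) n 1 * permModel 1 n 1 - permModel (r + 2) n 1 - permModel r n 1)
        * (w.map fun r => permModel r n 1).prod)) atTop (𝓝 0) := by
  set m := (r + 1 + w.sum) / 2
  set C : ℝ := (m : ℝ) ^ (r + 1 + 1 + w.sum) + r * (((r + w.sum) / 2 : ℕ) : ℝ) ^ (r + w.sum)
  have hlim : Tendsto (fun n : ℕ => C * (n : ℝ) ^ (-(1 / 2) : ℝ)) atTop (𝓝 0) := by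
    simpa using ((tendsto_rpow_neg_atTop (by norm_num : (0 : ℝ) < 1 / 2)).comp
      tendsto_natCast_atTop_atTop).const_mul C
  refine squeeze_zero_norm' ?_ hlim
  filter_upwards [eventually_gt_atTop 0] with n hn
  obtain ⟨e, he⟩ := exists_expansion_word n w
  have h1 := (remainder r n).norm_groupTrace_sum_mul_le e hn (remainder_moves r n)
  have h2 := ((cycleExpansion r n).mul e).norm_groupTrace_sum_le_half hn
  rw [Expansion.sum_mul, sum_cycleExpansion] at h2
  rw [show (r + 1 + 1 + w.sum - 1) / 2 = m by omega] at h1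
  have hn1 : (1 : ℝ) ≤ n := by exact_mod_cast hn
  have h3 : (n : ℝ) ^ ((r + w.sum) / 2) ≤ (n : ℝ) ^ m := pow_le_pow_right₀ hn1 (by omega)
  have hpow := norm_scale_mul_pow_le (r := r + 2 + w.sum) (k := m) hn (by omega)
  rw [prod_map_permModel w hn, permModel_recurrence r hn, smul_mul_smul_comm,
    scale_mul_scale _ _ hn, map_smul, sub_mul, map_sub, smul_mul_assoc, map_smul, ← he, norm_smul]
  calc ‖scale (r + 2 + w.sum) n‖ * ‖groupTrace ((remainder r n).sum * e.sum)
        - (r : ℂ) • groupTrace (cycleSum r n * e.sum)‖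
      ≤ ‖scale (r + 2 + w.sum) n‖ * (C * (n : ℝ) ^ m) := by
        gcongr
        refine (norm_sub_le _ _).trans ?_
        rw [norm_smul, Complex.norm_natCast, add_mul, mul_assoc]
        gcongr
        exact h2.trans (by gcongr)
    _ = C * (‖scale (r + 2 + w.sum) n‖ * (n : ℝ) ^ m) := by ring
    _ ≤ C * (n : ℝ) ^ (-(1 / 2) : ℝ) := by gcongr

/-! ### The ideal of negligible polynomials -/

/-- Induction principle: a linear condition on non-commutative polynomials has to be checked on
words. -/
theorem freeAlgebra_mem_of_words {V : Submodule ℂ (FreeAlgebra ℂ ℕ)}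
    (hV : ∀ w : List ℕ, (w.map (FreeAlgebra.ι ℂ)).prod ∈ V) (P : FreeAlgebra ℂ ℕ) : P ∈ V := by
  set W := Submodule.span ℂ (Set.range fun w : List ℕ => (w.map (FreeAlgebra.ι ℂ)).prod)
  -- Stability of `W` under left multiplication passes through products; `Q = 1` then gives the
  -- claim.
  have key : ∀ Q ∈ W, P * Q ∈ W := by
    induction P using FreeAlgebra.induction with
    | grade0 c =>
      intro Q hQ
      rw [← Algebra.smul_def]
      exact W.smul_mem c hQ
    | grade1 r =>
      intro Q hQ
      induction hQ using Submodule.span_induction with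
      | mem Q hQ =>
        obtain ⟨w, rfl⟩ := hQ
        exact Submodule.subset_span ⟨r :: w, by simp⟩
      | zero => simp
      | add Q Q' _ _ h h' => rw [mul_add]; exact W.add_mem h h'
      | smul c Q _ h => rw [mul_smul_comm]; exact W.smul_mem c h
    | mul P P' h h' => exact fun Q hQ => mul_assoc P P' Q ▸ h _ (h' _ hQ)
    | add P P' h h' => exact fun Q hQ => add_mul P P' Q ▸ W.add_mem (h _ hQ) (h' _ hQ)
  have hone : (1 : FreeAlgebra ℂ ℕ) ∈ W := Submodule.subset_span ⟨[], rfl⟩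
  have hW : W ≤ V := Submodule.span_le.2 (by rintro _ ⟨w, rfl⟩; exact hV w)
  exact hW (mul_one P ▸ key 1 hone)

/-- The distribution of the permutation model at time `1`. -/
abbrev permDistribution (n : ℕ) : FreeAlgebra ℂ ℕ →ₗ[ℂ] ℂ :=
  ncDistribution groupTrace fun r => permModel r n 1

theorem permDistribution_mul_comm (n : ℕ) (P Q : FreeAlgebra ℂ ℕ) :
    permDistribution n (P * Q) = permDistribution n (Q * P) := by
  simp only [permDistribution, ncDistribution, LinearMap.comp_apply, AlgHom.toLinearMap_apply,
    map_mul]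
  exact groupTrace_mul_comm _ _

/-- The space of the polynomials `P` such that `φ(P(M) Q(M)) → 0` for all `Q`. -/
def negligible : Submodule ℂ (FreeAlgebra ℂ ℕ) where
  carrier := {P | ∀ Q, Tendsto (fun n => permDistribution n (P * Q)) atTop (𝓝 0)}
  zero_mem' Q := by simp
  add_mem' h h' Q := by simpa [add_mul] using (h Q).add (h' Q)
  smul_mem' c P h Q := by simpa [smul_mul_assoc] using (h Q).const_mul c

theorem mul_mem_negligible_right {P : FreeAlgebra ℂ ℕ} (hP : P ∈ negligible)
    (Q : FreeAlgebra ℂ ℕ) : P * Q ∈ negligible :=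
  fun Q' => by simpa only [mul_assoc] using hP (Q * Q')

theorem mul_mem_negligible_left {P : FreeAlgebra ℂ ℕ} (hP : P ∈ negligible)
    (Q : FreeAlgebra ℂ ℕ) : Q * P ∈ negligible := fun Q' => by
  simpa only [mul_assoc, permDistribution_mul_comm _ Q] using hP (Q' * Q)

theorem recurrence_mem_negligible (r : ℕ) :
    FreeAlgebra.ι ℂ (r + 1) * FreeAlgebra.ι ℂ 1 - FreeAlgebra.ι ℂ (r + 2) - FreeAlgebra.ι ℂ r
      ∈ negligible := by
  set D : FreeAlgebra ℂ ℕ :=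
    FreeAlgebra.ι ℂ (r + 1) * FreeAlgebra.ι ℂ 1 - FreeAlgebra.ι ℂ (r + 2) - FreeAlgebra.ι ℂ r
  intro Q
  let V : Submodule ℂ (FreeAlgebra ℂ ℕ) :=
    { carrier := {Q | Tendsto (fun n => permDistribution n (D * Q)) atTop (𝓝 0)}
      zero_mem' := by simp
      add_mem' := fun h h' => by simpa [mul_add] using Tendsto.add h h'
      smul_mem' := fun c Q h => by simpa [mul_smul_comm] using Tendsto.const_mul c h }
  refine freeAlgebra_mem_of_words (V := V) (fun w => ?_) Q
  refine (tendsto_groupTrace_recurrence_mul r w).congr fun n => ?_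
  simp [permDistribution, ncDistribution, D, map_list_prod, Function.comp_def]

theorem ι_sub_aeval_S_mem_negligible (r : ℕ) :
    FreeAlgebra.ι ℂ r - aeval (FreeAlgebra.ι ℂ 1) (Chebyshev.S ℂ r) ∈ negligible := by
  induction r using Nat.twoStepInduction with
  | zero =>
    intro Q
    simp [permDistribution, ncDistribution, permModel_one, scale_zero, cycleSum_zero]
  | one => simp
  | more r h0 h1 =>
    have hS := Chebyshev.S_add_two ℂ r
    push_cast at h0 h1 ⊢
    -- `X` is put on the right to match the order of factors in `recurrence_mem_negligible`.
    rw [hS, mul_comm X, map_sub, map_mul, aeval_X]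
    have := negligible.sub_mem (negligible.sub_mem
      (mul_mem_negligible_right h1 (FreeAlgebra.ι ℂ 1)) h0) (recurrence_mem_negligible r)
    convert this using 1
    noncomm_ring

/-- Congruence modulo a two-sided ideal respects products: `PP' - QQ' = (P - Q)P' + Q(P' - Q')`. -/
theorem sub_aeval_chebyshevSubst_mem_negligible (P : FreeAlgebra ℂ ℕ) :
    P - aeval (FreeAlgebra.ι ℂ 1) (chebyshevSubst P) ∈ negligible := by
  induction P using FreeAlgebra.induction with
  | grade0 c => simp
  | grade1 r => simpa [chebyshevSubst] using ι_sub_aeval_S_mem_negligible r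
  | mul P P' h h' =>
    have := negligible.add_mem (mul_mem_negligible_right h P')
      (mul_mem_negligible_left h' (aeval (FreeAlgebra.ι ℂ 1) (chebyshevSubst P)))
    rw [map_mul, map_mul]
    convert this using 1
    noncomm_ring
  | add P P' h h' =>
    rw [map_add, map_add, add_sub_add_comm]
    exact negligible.add_mem h h'

theorem tendsto_permDistribution_of_sub_mem_negligible {P Q : FreeAlgebra ℂ ℕ} {c : ℂ}
    (h : P - Q ∈ negligible) (hQ : Tendsto (fun n => permDistribution n Q) atTop (𝓝 c)) :
    Tendsto (fun n => permDistribution n P) atTop (𝓝 c) := by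
  simpa using (h 1).add hQ

/-- By linearity `p = S r` suffices; it may be replaced by the generator `X_r`, whose trace is known
exactly. -/
theorem tendsto_permDistribution_aeval (p : ℂ[X]) :
    Tendsto (fun n => permDistribution n (aeval (FreeAlgebra.ι ℂ 1) p)) atTop
      (𝓝 (vacuumState (aeval (toeplitz 1) p))) := by
  have hp : p ∈ Submodule.span ℂ (Set.range fun r : ℕ => Chebyshev.S ℂ r) := by
    rw [span_range_chebyshev_S]
    trivial
  induction hp using Submodule.span_induction with
  | mem p hp =>
    obtain ⟨r, rfl⟩ := hp
    refine tendsto_permDistribution_of_sub_mem_negligible (Q := FreeAlgebra.ι ℂ r) ?_ ?_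
    · rw [← neg_sub]
      exact negligible.neg_mem (ι_sub_aeval_S_mem_negligible r)
    · refine tendsto_const_nhds.congr fun n => ?_
      rw [aeval_toeplitz_one_S, vacuumState_toeplitz]
      simp only [permDistribution, ncDistribution, LinearMap.comp_apply,
        AlgHom.toLinearMap_apply, FreeAlgebra.lift_ι_apply, permModel_one, map_smul,
        groupTrace_cycleSum]
      split_ifs with h
      · rw [h, scale_zero, one_smul]
      · rw [smul_zero]
  | zero => simp
  | add p q _ _ hp hq => simpa only [map_add] using hp.add hq
  | smul c p _ hp => simpa only [map_smul] using hp.const_smul c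

/-! ### Comparison of the distributions -/

theorem ncDistribution_eq_of_eq_aeval {A : Type*} [Ring A] [Algebra ℂ A] (φ : A →ₗ[ℂ] ℂ)
    {x : ℕ → A} {a : A} (hx : ∀ r : ℕ, x r = aeval a (Chebyshev.S ℂ r)) (P : FreeAlgebra ℂ ℕ) :
    ncDistribution φ x P = φ (aeval a (chebyshevSubst P)) :=
  congrArg φ (lift_eq_aeval_chebyshevSubst hx P)

theorem ncDistribution_toeplitz (P : FreeAlgebra ℂ ℕ) :
    ncDistribution vacuumState toeplitz P = vacuumState (aeval (toeplitz 1) (chebyshevSubst P)) :=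
  ncDistribution_eq_of_eq_aeval _ (fun r => (aeval_toeplitz_one_S r).symm) P

/-- Convergence in distribution of the permutation model to the Toeplitz operators. -/
theorem tendsto_permDistribution (P : FreeAlgebra ℂ ℕ) :
    Tendsto (fun n => permDistribution n P) atTop
      (𝓝 (ncDistribution vacuumState toeplitz P)) := by
  rw [ncDistribution_toeplitz]
  exact tendsto_permDistribution_of_sub_mem_negligible
    (sub_aeval_chebyshevSubst_mem_negligible P) (tendsto_permDistribution_aeval _)

end ToeplitzModel

end

theorem mainTheorem11 :
    -- `(𝒯, ω)` is a non-commutative probability space and the `T_r` are self-adjoint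
    ToeplitzModel.IsNCProbabilitySpace ToeplitzModel.vacuumState ∧
    (∀ r : ℕ, IsSelfAdjoint (ToeplitzModel.toeplitz r)) ∧
    -- the distribution of `(T_r)_r` is the limit distribution of the permutation model at time `1`
    (∀ P : FreeAlgebra ℂ ℕ, Filter.Tendsto
      (fun n : ℕ => ToeplitzModel.ncDistribution ToeplitzModel.groupTrace
        (fun r => ToeplitzModel.permModel r n 1) P)
      Filter.atTop
      (nhds (ToeplitzModel.ncDistribution ToeplitzModel.vacuumState ToeplitzModel.toeplitz P))) ∧
    -- it is the distribution of `(M_r(1))_r` for any realization of the limit family `(M_r(t))`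
    -- by a free Brownian motion and the polynomials `U_r`, here `Polynomial.Chebyshev.S`
    (∀ (A : Type*) [Ring A] [StarRing A] [Algebra ℂ A] [StarModule ℂ A] (φ : A →ₗ[ℂ] ℂ)
      (M : ℕ → NNReal → A),
      ToeplitzModel.IsNCProbabilitySpace φ →
      ToeplitzModel.IsFreeBrownianMotion φ (M 1) →
      (∀ (r : ℕ) (t : NNReal), 0 < t →
        M r t = (((t : ℝ) ^ ((r : ℝ) / 2) : ℝ) : ℂ) •
          Polynomial.aeval ((((t : ℝ) ^ (-(1 : ℝ) / 2) : ℝ) : ℂ) • M 1 t)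
            (Polynomial.Chebyshev.S ℂ r)) →
      ToeplitzModel.ncDistribution φ (fun r => M r 1) =
        ToeplitzModel.ncDistribution ToeplitzModel.vacuumState ToeplitzModel.toeplitz) := by
  refine ⟨ToeplitzModel.isNCProbabilitySpace_vacuumState, ToeplitzModel.isSelfAdjoint_toeplitz,
    ToeplitzModel.tendsto_permDistribution, ?_⟩
  intro A _ _ _ _ φ M _ hM hS
  refine LinearMap.ext fun P => ?_
  have hx (r : ℕ) : M r 1 = Polynomial.aeval (M 1 1) (Polynomial.Chebyshev.S ℂ r) := by
    simpa using hS r 1 one_pos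
  rw [ToeplitzModel.ncDistribution_eq_of_eq_aeval φ hx, ToeplitzModel.ncDistribution_toeplitz]
  exact (hM.semicircular 1).map_aeval_eq_vacuumState _
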